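/- A sequence $\{m_n\}_{n\ge 0}$ of real numbers is a Stieltjes moment sequence if there is a nonnegative measure $\mu$ on $[0,\infty)$ with $m_n=\int_{[0,\infty)}x^n\,d\mu(x)$ for all $n\ge 0$ (all moments being finite); it is Stieltjes-determinate if moreover this $\mu$ is unique. A Stieltjes moment sequence $\{m_n\}$ is called infinitely divisible if $\{m_n^c\}_{n\ge 0}$ is a Stieltjes moment sequence for every real $c>0$. Let $C_n=\frac{1}{n+1}\binom{2n}{n}$, $n\ge 0$, be the Catalan numbers. Theorem 1. (a) The Catalan sequence $\{C_n\}_{n\ge 0}$ is an infinitely divisible Stieltjes moment sequence. (b) For each real $c>0$, the power sequence $\{C_n^c\}_{n\ge 0}$ is Stieltjes-determinate. (c) For each real $c>0$, let $\mu_c$ be the measure on $[0,\infty)$ with moment sequence $\{C_n^c\}_{n\ge 0}$. Then $\mu_1$ is the measure with Lebesgue density $\frac{1}{2\pi}\sqrt{\frac{4-x}{x}}$ on $(0,4]$ and $0$ elsewhere, and for every real $c>0$ and every real $s\ge 0$ the function $t\mapsto t^s$ is $\mu_c$-integrable with $$\int_0^\infty t^s\,d\mu_c(t)=\left(\frac{2^{2s}}{\sqrt{\pi}}\cdot\frac{\Gamma(s+1/2)}{\Gamma(s+2)}\right)^c=\left(\frac{1}{s+1}\cdot\frac{\Gamma(2s+1)}{\Gamma(s+1)^2}\right)^c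 .$$ -/

import Mathlib

open MeasureTheory

noncomputable section

/-- `μ` is a nonnegative measure on `[0, ∞)` (viewed as a measure on `ℝ` giving no mass to the
negative half-line) all of whose moments are finite, the `n`-th one being `m n`. -/
def RepresentsMoments (μ : Measure ℝ) (m : ℕ → ℝ) : Prop :=
  μ (Set.Iio 0) = 0 ∧
    ∀ n : ℕ, Integrable (fun x : ℝ => x ^ n) μ ∧ ∫ x, x ^ n ∂μ = m n

/-- `m` is a Stieltjes moment sequence. -/
def IsStieltjesMomentSeq (m : ℕ → ℝ) : Prop :=
  ∃ μ : Measure ℝ, RepresentsMoments μ m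

/-- `m` is a Stieltjes determinate (S-det) sequence: it is the moment sequence of a measure
on `[0, ∞)`, and of only one. -/
def IsStieltjesDeterminate (m : ℕ → ℝ) : Prop :=
  ∃! μ : Measure ℝ, RepresentsMoments μ m

/-- `m` is an infinitely divisible Stieltjes moment sequence: it is a Stieltjes moment sequence
(in particular nonnegative), and so are all its positive real powers. -/
def IsInfinitelyDivisibleStieltjes (m : ℕ → ℝ) : Prop :=
  IsStieltjesMomentSeq m ∧
    ∀ c : ℝ, 0 < c → IsStieltjesMomentSeq (fun n => m n ^ c)

/-- The Catalan density `(1 / 2π) √((4 - x) / x)` on `(0, 4]`, zero elsewhere. -/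
def catalanDensity : ℝ → ℝ :=
  Set.indicator (Set.Ioc 0 4) fun x => 1 / (2 * Real.pi) * Real.sqrt ((4 - x) / x)

/-- The measure on `ℝ` whose density with respect to Lebesgue measure is the Catalan density. -/
def catalanMeasure : Measure ℝ :=
  volume.withDensity fun x => ENNReal.ofReal (catalanDensity x)

end

open Filter Topology unitInterval

/-! Interpolate `C_n` by `4^s Γ(s+1/2) / (√π Γ(s+2))`. By Euler's limit, `Γ(s+a)/Γ(s+b)` with `0 < a
≤ b` is a limit of positive constants times finite products of factors `(s+b+j)/(s+a+j)`. The `c`-th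
power of such a factor is a binomial series with nonnegative coefficients in a Mellin transform on
`[0,1]` (`add_div_add_rpow`). These transforms are stable under nonnegative combinations, products
and pointwise limits, so every power of the Gamma quotient is one; dilating by `4^c` gives `μ_c`,
with all its real moments at once.

Determinacy follows from `C_n^c ≤ (4^c)^n`: any representing measure lives on `[0, 4^c]`, so its
moments give its characteristic function (`RepresentsMoments.unique`). For `c = 1` the explicit
density has the right moments by a Beta integral, and uniqueness concludes. -/

/-- `f` is, on `[0, ∞)`, the Mellin transform `s ↦ ∫ x ^ s dμ` of a finite measure on `[0, 1]`. -/
def IsUnitMellin (f : ℝ → ℝ) : Prop :=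
  ∃ μ : Measure I, IsFiniteMeasure μ ∧ ∀ s : ℝ, 0 ≤ s → ∫ x, (x : ℝ) ^ s ∂μ = f s

lemma continuous_unitInterval_rpow {s : ℝ} (hs : 0 ≤ s) : Continuous fun x : I => (x : ℝ) ^ s :=
  continuous_subtype_val.rpow_const fun _ => Or.inr hs

lemma integrable_of_continuous_unitInterval {μ : Measure I} [IsFiniteMeasure μ] {f : I → ℝ}
    (hf : Continuous f) : Integrable f μ :=
  hf.integrable_of_hasCompactSupport (HasCompactSupport.of_compactSpace f)

/-! ### Mellin transforms on `[0,1]` and powers of Gamma quotients. -/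

namespace IsUnitMellin

lemma congr {f g : ℝ → ℝ} (hf : IsUnitMellin f) (h : ∀ s, 0 ≤ s → f s = g s) :
    IsUnitMellin g := by
  obtain ⟨μ, hμ, hf⟩ := hf
  exact ⟨μ, hμ, fun s hs => (hf s hs).trans (h s hs)⟩

lemma zero : IsUnitMellin fun _ => 0 := ⟨0, inferInstance, fun s _ => by simp⟩

lemma one : IsUnitMellin fun _ => 1 :=
  ⟨Measure.dirac 1, inferInstance, fun s _ => by simp⟩

lemma const_mul {f : ℝ → ℝ} (hf : IsUnitMellin f) {c : ℝ} (hc : 0 ≤ c) :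
    IsUnitMellin fun s => c * f s := by
  obtain ⟨μ, hμ, hf⟩ := hf
  refine ⟨c.toNNReal • μ, inferInstance, fun s hs => ?_⟩
  rw [integral_smul_nnreal_measure, hf s hs, NNReal.smul_def, Real.coe_toNNReal c hc, smul_eq_mul]

lemma add {f g : ℝ → ℝ} (hf : IsUnitMellin f) (hg : IsUnitMellin g) :
    IsUnitMellin fun s => f s + g s := by
  obtain ⟨μ, hμ, hf⟩ := hf
  obtain ⟨ν, hν, hg⟩ := hg
  refine ⟨μ + ν, inferInstance, fun s hs => ?_⟩
  rw [integral_add_measure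
    (integrable_of_continuous_unitInterval (continuous_unitInterval_rpow hs))
    (integrable_of_continuous_unitInterval (continuous_unitInterval_rpow hs)), hf s hs, hg s hs]

/-- Multiplicative convolution: the law of a product of independent variables. -/
lemma mul {f g : ℝ → ℝ} (hf : IsUnitMellin f) (hg : IsUnitMellin g) :
    IsUnitMellin fun s => f s * g s := by
  obtain ⟨μ, hμ, hf⟩ := hf
  obtain ⟨ν, hν, hg⟩ := hg
  refine ⟨(μ.prod ν).map fun p : I × I => p.1 * p.2, inferInstance, fun s hs => ?_⟩
  beta_reduce
  rw [integral_map (by fun_prop)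
    (continuous_unitInterval_rpow hs).aestronglyMeasurable, ← hf s hs, ← hg s hs, ← integral_prod_mul]
  refine integral_congr_ae (ae_of_all _ fun p => ?_)
  simp [Real.mul_rpow p.1.2.1 p.2.2.1]

lemma pow {f : ℝ → ℝ} (hf : IsUnitMellin f) (n : ℕ) : IsUnitMellin fun s => f s ^ n := by
  induction n with
  | zero => simpa using one
  | succ n ih => simpa [pow_succ] using ih.mul hf

lemma sum {f : ℕ → ℝ → ℝ} (hf : ∀ k, IsUnitMellin (f k)) (n : ℕ) :
    IsUnitMellin fun s => ∑ k ∈ Finset.range n, f k s := by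
  induction n with
  | zero => simpa using zero
  | succ n ih => simpa [Finset.sum_range_succ] using ih.add (hf n)

lemma prod {f : ℕ → ℝ → ℝ} (hf : ∀ k, IsUnitMellin (f k)) (n : ℕ) :
    IsUnitMellin fun s => ∏ k ∈ Finset.range n, f k s := by
  induction n with
  | zero => simpa using one
  | succ n ih => simpa [Finset.prod_range_succ] using ih.mul (hf n)

/-- Mellin transforms of finite measures on `[0, 1]` are closed under pointwise limits, by weak
compactness of the set of measures of bounded mass. -/
lemma of_tendsto {f : ℕ → ℝ → ℝ} {g : ℝ → ℝ} (hf : ∀ k, IsUnitMellin (f k))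
    (h : ∀ s, 0 ≤ s → Tendsto (fun k => f k s) atTop (𝓝 (g s))) : IsUnitMellin g := by
  choose μ hμ hμf using hf
  obtain ⟨C, hC⟩ := (h 0 le_rfl).bddAbove_range
  let m : ℕ → FiniteMeasure I := fun k => ⟨μ k, hμ k⟩
  have hm (k : ℕ) : (m k).mass ≤ C.toNNReal := by
    -- Since `x ^ 0 = 1` even at `x = 0`, the value at `s = 0` is the total mass; convergence there
    -- bounds all the masses.
    have h0 := hμf k 0 le_rfl
    simp only [Real.rpow_zero, integral_const, smul_eq_mul, mul_one] at h0
    rw [← NNReal.coe_le_coe]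
    have hmass : ((m k).mass : ℝ) = f k 0 := h0
    rw [hmass]
    exact (hC ⟨k, rfl⟩).trans (Real.le_coe_toNNReal C)
  have hK : IsCompact {ν : FiniteMeasure I | ν.mass ≤ C.toNNReal} :=
    isCompact_setOfPred_finiteMeasure_le_of_compactSpace I C.toNNReal
  obtain ⟨ν, -, hν⟩ := hK.exists_mapClusterPt (f := (atTop : Filter ℕ)) (u := m) (by
    simp only [le_principal_iff, mem_map]
    exact Eventually.of_forall hm)
  refine ⟨ν, inferInstance, fun s hs => ?_⟩
  let φ : BoundedContinuousFunction I ℝ :=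
    BoundedContinuousFunction.mkOfCompact ⟨_, continuous_unitInterval_rpow hs⟩
  have hc : ContinuousAt (fun ν : FiniteMeasure I => ∫ x, φ x ∂(ν : Measure I)) ν :=
    FiniteMeasure.tendsto_iff_forall_integral_tendsto.1 tendsto_id φ
  have hcl := hν.tendsto_comp hc
  have hlim : Tendsto ((fun ν : FiniteMeasure I => ∫ x, φ x ∂(ν : Measure I)) ∘ m) atTop
      (𝓝 (g s)) := by
    refine (h s hs).congr fun k => ?_
    exact (hμf k s hs).symm
  -- Integration against `φ` maps `ν` to a cluster point of a convergent sequence, hence to its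
  -- limit.
  have : (𝓝 (∫ x, φ x ∂(ν : Measure I)) ⊓ 𝓝 (g s)).NeBot :=
    Filter.NeBot.mono hcl (inf_le_inf_left _ hlim)
  exact eq_of_nhds_neBot this

/-- The law of `U^(1/b)` for `U` uniform on `[0,1]`. -/
lemma div_add {b : ℝ} (hb : 0 < b) : IsUnitMellin fun s => b / (s + b) := by
  have hb' : 0 ≤ b⁻¹ := by positivity
  let r : I → I := fun x => ⟨(x : ℝ) ^ b⁻¹, Real.rpow_nonneg x.2.1 _,
    Real.rpow_le_one x.2.1 x.2.2 hb'⟩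
  have hr : Continuous r := (continuous_unitInterval_rpow hb').subtype_mk _
  refine ⟨(volume : Measure I).map r, inferInstance, fun s hs => ?_⟩
  rw [integral_map hr.aemeasurable (continuous_unitInterval_rpow hs).aestronglyMeasurable]
  have h1 : ∫ x : I, (r x : ℝ) ^ s = ∫ x : I, (x : ℝ) ^ (b⁻¹ * s) :=
    integral_congr_ae (ae_of_all _ fun x => by simp [r, Real.rpow_mul x.2.1])
  have h2 : ∫ x : I, (x : ℝ) ^ (b⁻¹ * s) = ∫ x in Set.Icc (0 : ℝ) 1, x ^ (b⁻¹ * s) :=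
    integral_subtype measurableSet_Icc fun x : ℝ => x ^ (b⁻¹ * s)
  have hbs : 0 ≤ b⁻¹ * s := by positivity
  rw [h1, h2, integral_Icc_eq_integral_Ioc, ← intervalIntegral.integral_of_le zero_le_one,
    integral_rpow (Or.inl (by linarith)), Real.one_rpow, Real.zero_rpow (by linarith)]
  field_simp
  ring

/-- The binomial series of `(1 - y)^(-c)` has nonnegative coefficients, so its partial sums at `y =
q f` stay in the class. -/
lemma one_div_one_sub_rpow {f : ℝ → ℝ} (hf : IsUnitMellin f) {q c : ℝ} (hq : 0 ≤ q)
    (hc : 0 < c) (h : ∀ s, 0 ≤ s → |q * f s| < 1) :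
    IsUnitMellin fun s => 1 / (1 - q * f s) ^ c := by
  have hcoef (n : ℕ) : 0 ≤ Ring.choose (c + n - 1) n := by
    have h1 := Ring.factorial_nsmul_multichoose_eq_ascPochhammer c n
    rw [Polynomial.ascPochhammer_smeval_eq_eval, nsmul_eq_mul] at h1
    have h2 : 0 < (n.factorial : ℝ) := by positivity
    have h3 : 0 ≤ Ring.multichoose c n :=
      nonneg_of_mul_nonneg_right (h1 ▸ (ascPochhammer_pos n c hc).le) h2
    rwa [Ring.multichoose_eq] at h3
  refine of_tendsto (f := fun n s =>
    ∑ k ∈ Finset.range n, Ring.choose (c + k - 1) k * (q * f s) ^ k)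
    (sum fun k => ((hf.const_mul hq).pow k).const_mul (hcoef k)) fun s hs => ?_
  have := (Real.one_div_one_sub_rpow_hasFPowerSeriesOnBall_zero c).hasSum (y := q * f s) (by
    rw [Metric.mem_eball, edist_zero_right, ← ofReal_norm, ENNReal.ofReal_lt_one]
    exact h s hs)
  simpa [mul_comm, FormalMultilinearSeries.ofScalars_apply_eq] using this.tendsto_sum_nat

lemma add_div_add_rpow {a b c : ℝ} (ha : 0 < a) (hab : a ≤ b) (hc : 0 < c) :
    IsUnitMellin fun s => ((s + b) / (s + a)) ^ c := by
  have hb : 0 < b := ha.trans_le hab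
  have hq (s : ℝ) (hs : 0 ≤ s) : 1 - (b - a) / b * (b / (s + b)) = (s + a) / (s + b) := by
    have : 0 < s + b := by positivity
    field_simp
    ring
  have h0 : 0 ≤ (b - a) / b := div_nonneg (sub_nonneg.2 hab) hb.le
  refine ((div_add hb).one_div_one_sub_rpow (q := (b - a) / b) h0 hc ?_).congr ?_
  · intro s hs
    rw [abs_of_nonneg (by positivity)]
    have := hq s hs
    have : 0 < (s + a) / (s + b) := by positivity
    linarith
  · intro s hs
    rw [hq s hs, one_div, ← Real.inv_rpow (by positivity), inv_div]

/-- Quotients of Gamma functions are infinitely divisible Mellin transforms on `[0, 1]`. -/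
lemma Gamma_div_Gamma_rpow {a b c : ℝ} (ha : 0 < a) (hab : a ≤ b) (hc : 0 < c) :
    IsUnitMellin fun s => (Real.Gamma (s + a) / Real.Gamma (s + b)) ^ c := by
  have hb : 0 < b := ha.trans_le hab
  refine of_tendsto (f := fun n s => ((n : ℝ) ^ (a - b)) ^ c *
    ∏ j ∈ Finset.range (n + 1), ((s + (b + j)) / (s + (a + j))) ^ c)
    (fun n => (prod (fun j => add_div_add_rpow (by positivity) (by linarith) hc) _).const_mul
      (by positivity)) fun s hs => ?_
  have hlim := ((Real.GammaSeq_tendsto_Gamma (s + a)).div (Real.GammaSeq_tendsto_Gamma (s + b))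
    -- In the quotient of the two Euler sequences the factorials cancel, leaving `n^(a-b)` and the
    -- product over `j ≤ n`.
    (Real.Gamma_pos_of_pos (by positivity)).ne').rpow_const (p := c) (Or.inr hc.le)
  refine hlim.congr' ?_
  filter_upwards [eventually_gt_atTop 0] with n hn
  have hn' : (0 : ℝ) < n := by exact_mod_cast hn
  have hpos (t : ℝ) (ht : 0 < t) : 0 < ∏ j ∈ Finset.range (n + 1), (s + t + (j : ℝ)) :=
    Finset.prod_pos fun j _ => by positivity
  have hA := hpos a ha
  have hB := hpos b hb
  rw [Real.finsetProd_rpow _ _ fun j _ => by positivity, ← Real.mul_rpow (by positivity)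
    (Finset.prod_nonneg fun j _ => by positivity), Finset.prod_div_distrib]
  simp only [← add_assoc, Pi.div_apply, Real.GammaSeq]
  congr 1
  rw [show a - b = (s + a) - (s + b) by ring, Real.rpow_sub hn']
  have h1 : (0 : ℝ) < (n : ℝ) ^ (s + b) := by positivity
  field_simp

end IsUnitMellin

/-! ### Determinacy under geometric moment growth. -/

lemma RepresentsMoments.isFiniteMeasure {μ : Measure ℝ} {m : ℕ → ℝ}
    (hμ : RepresentsMoments μ m) : IsFiniteMeasure μ := by
  have h := (hμ.2 0).1
  simp only [pow_zero] at h
  rwa [integrable_const_iff_isFiniteMeasure one_ne_zero] at h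

/-- Moments growing at most geometrically, at rate `R`, force the measure to live on `[0, R]`. -/
lemma RepresentsMoments.ae_mem_Icc {μ : Measure ℝ} {m : ℕ → ℝ} {R : ℝ}
    (hμ : RepresentsMoments μ m) (hR : 0 < R) (hm : ∀ n, m n ≤ R ^ n) :
    ∀ᵐ x ∂μ, x ∈ Set.Icc 0 R := by
  have h0 : ∀ᵐ x ∂μ, 0 ≤ x := by
    rw [ae_iff]
    convert hμ.1 using 2
    ext x
    simp
  have hfin : IsFiniteMeasure μ := hμ.isFiniteMeasure
  have key (k : ℕ) : ∀ᵐ x ∂μ, x ≤ R + 1 / ((k : ℝ) + 1) := by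
    set ρ : ℝ := R + 1 / ((k : ℝ) + 1) with hρdef
    have hρ : R < ρ := by
      have : (0 : ℝ) < 1 / ((k : ℝ) + 1) := by positivity
      linarith
    have hρ0 : 0 < ρ := hR.trans hρ
    -- Markov's inequality for `x ^ n`; letting `n → ∞` kills the mass beyond any `ρ > R`.
    have hbound (n : ℕ) : μ.real {x | ρ ≤ x} ≤ (R / ρ) ^ n := by
      have h1 : ρ ^ n * μ.real {x | ρ ^ n ≤ x ^ n} ≤ ∫ x, x ^ n ∂μ :=
        mul_meas_ge_le_integral_of_nonneg
          (h0.mono fun x hx => pow_nonneg hx n) (hμ.2 n).1 _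
      have h2 : μ.real {x | ρ ≤ x} ≤ μ.real {x | ρ ^ n ≤ x ^ n} :=
        measureReal_mono fun x hx => pow_le_pow_left₀ hρ0.le hx n
      rw [div_pow, le_div_iff₀ (by positivity), mul_comm]
      calc ρ ^ n * μ.real {x | ρ ≤ x} ≤ ρ ^ n * μ.real {x | ρ ^ n ≤ x ^ n} := by gcongr
        _ ≤ R ^ n := h1.trans ((hμ.2 n).2.le.trans (hm n))
    have hlim : Tendsto (fun n : ℕ => (R / ρ) ^ n) atTop (𝓝 0) :=
      tendsto_pow_atTop_nhds_zero_of_lt_one (by positivity) ((div_lt_one hρ0).2 hρ)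
    have hz : μ.real {x | ρ ≤ x} = 0 :=
      le_antisymm (ge_of_tendsto' hlim hbound) measureReal_nonneg
    rw [measureReal_eq_zero_iff] at hz
    rw [ae_iff]
    exact measure_mono_null (fun x hx => (not_le.1 hx).le) hz
  filter_upwards [h0, ae_all_iff.2 key] with x hx hk
  refine ⟨hx, ge_of_tendsto' (b := x) (x := atTop) ?_ hk⟩
  simpa using tendsto_const_nhds.add (tendsto_one_div_add_atTop_nhds_zero_nat (𝕜 := ℝ))

/-- Two measures with the same, at most geometrically growing, moments coincide. -/
lemma RepresentsMoments.unique {μ ν : Measure ℝ} {m : ℕ → ℝ} {R : ℝ}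
    (hμ : RepresentsMoments μ m) (hν : RepresentsMoments ν m) (hR : 0 < R)
    (hm : ∀ n, m n ≤ R ^ n) : μ = ν := by
  have hchar (κ : Measure ℝ) (hκ : RepresentsMoments κ m) : IsFiniteMeasure κ ∧ ∀ t : ℝ,
      HasSum (fun n : ℕ => ((t : ℂ) * Complex.I) ^ n / n.factorial * (m n : ℂ))
        (charFun κ t) := by
    have hfin : IsFiniteMeasure κ := hκ.isFiniteMeasure
    refine ⟨hfin, fun t => ?_⟩
    rw [charFun_apply_real]
    have hs : Summable fun n : ℕ => (|t| * R) ^ n / n.factorial :=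
      Real.summable_pow_div_factorial _
    -- Integrate the exponential series termwise; the support in `[0, R]` gives the majorant.
    have hsum := hasSum_integral_of_dominated_convergence (μ := κ)
      (F := fun (n : ℕ) (x : ℝ) => ((t : ℂ) * Complex.I) ^ n / n.factorial * ((x ^ n : ℝ) : ℂ))
      (f := fun x => Complex.exp (t * x * Complex.I))
      (fun n _ => (|t| * R) ^ n / n.factorial)
      (fun n => by fun_prop) (fun n => ?_) (ae_of_all _ fun _ => hs) (integrable_const _)
      (ae_of_all _ fun x => ?_)
    · refine hsum.congr_fun fun n => ?_
      rw [integral_const_mul, integral_complex_ofReal, (hκ.2 n).2]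
    · filter_upwards [hκ.ae_mem_Icc hR hm] with x hx
      simp only [norm_mul, norm_div, norm_pow, Complex.norm_real, Complex.norm_I, mul_one,
        Real.norm_eq_abs, Complex.norm_natCast, abs_of_nonneg hx.1]
      rw [div_mul_eq_mul_div, ← mul_pow]
      gcongr
      exacts [mul_nonneg (abs_nonneg t) hx.1, hx.2]
    · have h := NormedSpace.expSeries_div_hasSum_exp (𝔸 := ℂ) ((t : ℂ) * x * Complex.I)
      rw [← Complex.exp_eq_exp_ℂ] at h
      refine HasSum.congr_fun h fun n => ?_
      rw [mul_right_comm, mul_pow]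
      push_cast
      ring
  obtain ⟨hμf, hμc⟩ := hchar μ hμ
  obtain ⟨hνf, hνc⟩ := hchar ν hν
  exact Measure.ext_of_charFun (funext fun t => (hμc t).unique (hνc t))

/-! ### Catalan numbers, Gamma values and the measures `μ_c`. -/

/-- The Gamma function interpolation of the Catalan numbers. -/
lemma gamma_duplication_catalan {s : ℝ} (hs : 0 ≤ s) :
    (2 : ℝ) ^ (2 * s) / Real.sqrt Real.pi * (Real.Gamma (s + 1 / 2) / Real.Gamma (s + 2)) =
      1 / (s + 1) * (Real.Gamma (2 * s + 1) / Real.Gamma (s + 1) ^ 2) := by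
  -- Legendre duplication at `s + 1/2`.
  have h := Real.Gamma_mul_Gamma_add_half (s + 1 / 2)
  rw [show s + 1 / 2 + 1 / 2 = s + 1 by ring, show 2 * (s + 1 / 2) = 2 * s + 1 by ring,
    show 1 - (2 * s + 1) = -(2 * s) by ring, Real.rpow_neg zero_le_two] at h
  have hG : 0 < Real.Gamma (s + 1) := Real.Gamma_pos_of_pos (by positivity)
  have h2 : (0 : ℝ) < 2 ^ (2 * s) := by positivity
  have hπ : 0 < Real.sqrt Real.pi := Real.sqrt_pos.2 Real.pi_pos
  have hs1 : 0 < s + 1 := by positivity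
  rw [show s + 2 = s + 1 + 1 by ring, Real.Gamma_add_one hs1.ne']
  rw [← eq_div_iff hG.ne'] at h
  rw [h]
  field_simp

lemma catalan_eq_gamma (n : ℕ) :
    (catalan n : ℝ) = 1 / ((n : ℝ) + 1) *
      (Real.Gamma (2 * (n : ℝ) + 1) / Real.Gamma ((n : ℝ) + 1) ^ 2) := by
  have h1 : Real.Gamma (2 * (n : ℝ) + 1) = (2 * n).factorial := by
    rw [← Real.Gamma_nat_eq_factorial]
    push_cast
    rfl
  have h2 : ((n : ℝ) + 1) * catalan n = n.centralBinom := by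
    exact_mod_cast succ_mul_catalan_eq_centralBinom n
  have h3 : (n.centralBinom : ℝ) * n.factorial * n.factorial = (2 * n).factorial := by
    have := Nat.choose_mul_factorial_mul_factorial (n := 2 * n) (k := n) (by omega)
    rw [show 2 * n - n = n by omega, ← Nat.centralBinom_eq_two_mul_choose] at this
    exact_mod_cast this
  rw [h1, Real.Gamma_nat_eq_factorial, ← h3, ← h2]
  have : (0 : ℝ) < n.factorial := by positivity
  field_simp

lemma catalan_le_four_pow (n : ℕ) : (catalan n : ℝ) ≤ 4 ^ n := by
  have h1 : catalan n ≤ n.centralBinom := by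
    rw [catalan_eq_centralBinom_div]
    exact Nat.div_le_self _ _
  have h2 : n.centralBinom ≤ 4 ^ n := by
    rw [Nat.centralBinom_eq_two_mul_choose]
    calc (2 * n).choose n ≤ 2 ^ (2 * n) := Nat.choose_le_two_pow _ _
      _ = 4 ^ n := by rw [pow_mul]; norm_num
  exact_mod_cast h1.trans h2

lemma catalan_rpow_le {c : ℝ} (hc : 0 < c) (n : ℕ) : (catalan n : ℝ) ^ c ≤ ((4 : ℝ) ^ c) ^ n := by
  rw [← Real.rpow_natCast, ← Real.rpow_mul (by norm_num), mul_comm c, Real.rpow_mul (by norm_num),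
    Real.rpow_natCast]
  exact Real.rpow_le_rpow (by positivity) (catalan_le_four_pow n) hc.le

/-- A measure whose Mellin transform is the `c`-th power of that of the Catalan measure. -/
lemma exists_catalan_rpow_measure {c : ℝ} (hc : 0 < c) :
    ∃ μ : Measure ℝ, RepresentsMoments μ (fun n => (catalan n : ℝ) ^ c) ∧
      ∀ s : ℝ, 0 ≤ s → Integrable (fun t : ℝ => t ^ s) μ ∧
        ∫ t, t ^ s ∂μ = ((2 : ℝ) ^ (2 * s) / Real.sqrt Real.pi *
          (Real.Gamma (s + 1 / 2) / Real.Gamma (s + 2))) ^ c := by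
  obtain ⟨ν, hν, h⟩ := (IsUnitMellin.Gamma_div_Gamma_rpow (a := 1 / 2) (b := 2) (by norm_num)
    (by norm_num) hc).const_mul (c := (1 / Real.sqrt Real.pi) ^ c) (by positivity)
  -- Dilation by `4^c` supplies the factor `4^(cs) = (2^(2s))^c`.
  let r : I → ℝ := fun x => (4 : ℝ) ^ c * x
  have hr : Continuous r := by fun_prop
  have hmellin (s : ℝ) (hs : 0 ≤ s) : Integrable (fun t : ℝ => t ^ s) (ν.map r) ∧
      ∫ t, t ^ s ∂(ν.map r) = ((2 : ℝ) ^ (2 * s) / Real.sqrt Real.pi *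
          (Real.Gamma (s + 1 / 2) / Real.Gamma (s + 2))) ^ c := by
    have hcont : Continuous fun t : ℝ => t ^ s := Real.continuous_rpow_const hs
    refine ⟨(integrable_map_measure hcont.aestronglyMeasurable hr.aemeasurable).2
      (integrable_of_continuous_unitInterval (hcont.comp hr)), ?_⟩
    rw [integral_map hr.aemeasurable hcont.aestronglyMeasurable]
    have hmul : ∀ x : I, r x ^ s = ((2 : ℝ) ^ (2 * s)) ^ c * (x : ℝ) ^ s := fun x => by
      have : ((4 : ℝ) ^ c) ^ s = ((2 : ℝ) ^ (2 * s)) ^ c := by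
        rw [← Real.rpow_mul (by norm_num), ← Real.rpow_mul (by norm_num),
          show (4 : ℝ) = 2 ^ (2 : ℝ) by norm_num, ← Real.rpow_mul (by norm_num)]
        congr 1
        ring
      rw [← this, Real.mul_rpow (by positivity) x.2.1]
    have hG1 : 0 < Real.Gamma (s + 1 / 2) := Real.Gamma_pos_of_pos (by positivity)
    have hG2 : 0 < Real.Gamma (s + 2) := Real.Gamma_pos_of_pos (by positivity)
    simp_rw [hmul]
    rw [integral_const_mul, h s hs, ← mul_assoc, ← Real.mul_rpow (by positivity) (by positivity),
      ← Real.mul_rpow (by positivity) (by positivity), mul_one_div]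
  refine ⟨ν.map r, ⟨?_, fun n => ?_⟩, hmellin⟩
  · rw [Measure.map_apply hr.measurable measurableSet_Iio]
    convert measure_empty (μ := ν)
    ext x
    have : 0 ≤ r x := mul_nonneg (by positivity) x.2.1
    simpa using this
  · obtain ⟨h1, h2⟩ := hmellin n n.cast_nonneg
    simp only [Real.rpow_natCast] at h1 h2
    refine ⟨h1, ?_⟩
    rw [h2, gamma_duplication_catalan n.cast_nonneg, ← catalan_eq_gamma]

/-! ### The explicit Catalan density. -/

/-- Real form of the Beta integral over `(0, a]`. -/
lemma integral_Ioc_rpow_mul_sub_rpow {a p q : ℝ} (ha : 0 < a) (hp : 0 < p) (hq : 0 < q) :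
    ∫ x in Set.Ioc 0 a, x ^ (p - 1) * (a - x) ^ (q - 1) =
      a ^ (p + q - 1) * (Real.Gamma p * Real.Gamma q / Real.Gamma (p + q)) := by
  have h := Complex.betaIntegral_scaled p q ha
  rw [Complex.betaIntegral_eq_Gamma_mul_div _ _ (by simpa) (by simpa),
    intervalIntegral.integral_of_le ha.le] at h
  have h1 : ∫ x in Set.Ioc 0 a, (x : ℂ) ^ ((p : ℂ) - 1) * ((a : ℂ) - x) ^ ((q : ℂ) - 1) =
      ∫ x in Set.Ioc 0 a, ((x ^ (p - 1) * (a - x) ^ (q - 1) : ℝ) : ℂ) := by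
    refine setIntegral_congr_fun measurableSet_Ioc fun x hx => ?_
    rw [Complex.ofReal_mul, Complex.ofReal_cpow hx.1.le, Complex.ofReal_cpow (sub_nonneg.2 hx.2)]
    push_cast
    rfl
  rw [h1, integral_complex_ofReal] at h
  apply Complex.ofReal_injective
  refine h.trans ?_
  rw [Complex.ofReal_mul, Complex.ofReal_cpow ha.le]
  push_cast [← Complex.Gamma_ofReal]
  rfl

lemma representsMoments_catalanMeasure :
    RepresentsMoments catalanMeasure fun n => (catalan n : ℝ) := by
  have hmeas : Measurable catalanDensity :=
    Measurable.indicator (by fun_prop) measurableSet_Ioc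
  have hnn (x : ℝ) : 0 ≤ catalanDensity x := Set.indicator_nonneg (fun x _ => by positivity) x
  -- The Beta integrand with `p = n + 1/2`, `q = 3/2`.
  have hdens (n : ℕ) : (fun x : ℝ => catalanDensity x * x ^ n) =
      Set.indicator (Set.Ioc 0 4) fun x => 1 / (2 * Real.pi) *
        (x ^ ((n + 1 / 2 : ℝ) - 1) * (4 - x) ^ ((3 / 2 : ℝ) - 1)) := by
    ext x
    by_cases hx : x ∈ Set.Ioc (0 : ℝ) 4
    · rw [catalanDensity, Set.indicator_of_mem hx, Set.indicator_of_mem hx, mul_assoc]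
      congr 1
      rw [Real.sqrt_div (sub_nonneg.2 hx.2), Real.sqrt_eq_rpow, Real.sqrt_eq_rpow,
        show (n + 1 / 2 : ℝ) - 1 = n - 1 / 2 by ring, Real.rpow_sub hx.1, Real.rpow_natCast]
      norm_num
      ring
    · rw [catalanDensity, Set.indicator_of_notMem hx, Set.indicator_of_notMem hx, zero_mul]
  have hval (n : ℕ) : ∫ x, catalanDensity x * x ^ n = catalan n := by
    rw [hdens n, integral_indicator measurableSet_Ioc, integral_const_mul,
      integral_Ioc_rpow_mul_sub_rpow (by norm_num) (by positivity) (by norm_num),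
      catalan_eq_gamma, ← gamma_duplication_catalan n.cast_nonneg,
      show (3 / 2 : ℝ) = 1 / 2 + 1 by norm_num, Real.Gamma_add_one (by norm_num),
      Real.Gamma_one_half_eq, show (n : ℝ) + 1 / 2 + (1 / 2 + 1) = n + 2 by ring,
      show (n : ℝ) + 2 - 1 = n + 1 by ring, Real.rpow_add_one (by norm_num), Real.rpow_mul (by norm_num)]
    have hπ : 0 < Real.sqrt Real.pi := Real.sqrt_pos.2 Real.pi_pos
    have hG : 0 < Real.Gamma ((n : ℝ) + 2) := Real.Gamma_pos_of_pos (by positivity)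
    rw [show Real.pi = Real.sqrt Real.pi * Real.sqrt Real.pi from
      (Real.mul_self_sqrt Real.pi_pos.le).symm]
    norm_num
    field_simp
    norm_num
  refine ⟨?_, fun n => ⟨?_, ?_⟩⟩
  · rw [catalanMeasure, withDensity_apply _ measurableSet_Iio]
    refine setLIntegral_eq_zero measurableSet_Iio fun x hx => ?_
    have : x ∉ Set.Ioc (0 : ℝ) 4 := fun h => lt_asymm h.1 hx
    simp [catalanDensity, this]
  · rw [catalanMeasure, integrable_withDensity_iff_integrable_smul' (by fun_prop) (by simp)]
    simp only [ENNReal.toReal_ofReal (hnn _), smul_eq_mul]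
    -- A non-integrable function has integral `0` by convention, but this one has value `C_n > 0`.
    by_contra hni
    have h0 := (hval n).symm.trans (integral_undef hni)
    have hpos : (0 : ℝ) < catalan n := by
      rw [catalan_eq_gamma]
      have := Real.Gamma_pos_of_pos (s := 2 * (n : ℝ) + 1) (by positivity)
      have := Real.Gamma_pos_of_pos (s := (n : ℝ) + 1) (by positivity)
      positivity
    exact hpos.ne' h0
  · rw [catalanMeasure, integral_withDensity_eq_integral_toReal_smul (by fun_prop) (by simp)]
    simp only [ENNReal.toReal_ofReal (hnn _), smul_eq_mul]
    exact hval n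

theorem theorem1 :
    -- (a) the Catalan sequence is infinitely divisible
    IsInfinitelyDivisibleStieltjes (fun n => (catalan n : ℝ)) ∧
    -- (b) all its positive powers are Stieltjes determinate
    (∀ c : ℝ, 0 < c → IsStieltjesDeterminate (fun n => (catalan n : ℝ) ^ c)) ∧
    -- (c) the representing measures: the case `c = 1`, and the Mellin transforms
    (∀ c : ℝ, 0 < c → ∀ μ : Measure ℝ,
      RepresentsMoments μ (fun n => (catalan n : ℝ) ^ c) →
        (c = 1 → μ = catalanMeasure) ∧
        ∀ s : ℝ, 0 ≤ s →
          Integrable (fun t : ℝ => t ^ s) μ ∧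
          ∫ t, t ^ s ∂μ =
            ((2 : ℝ) ^ (2 * s) / Real.sqrt Real.pi *
              (Real.Gamma (s + 1 / 2) / Real.Gamma (s + 2))) ^ c ∧
          ∫ t, t ^ s ∂μ =
            (1 / (s + 1) * (Real.Gamma (2 * s + 1) / Real.Gamma (s + 1) ^ 2)) ^ c) := by
  have hdet {c : ℝ} (hc : 0 < c) {μ ν : Measure ℝ}
      (hμ : RepresentsMoments μ fun n => (catalan n : ℝ) ^ c)
      (hν : RepresentsMoments ν fun n => (catalan n : ℝ) ^ c) : μ = ν :=
    hμ.unique hν (by positivity) (catalan_rpow_le hc)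
  refine ⟨⟨⟨catalanMeasure, representsMoments_catalanMeasure⟩, fun c hc => ?_⟩, fun c hc => ?_,
    fun c hc μ hμ => ⟨?_, fun s hs => ?_⟩⟩
  · obtain ⟨μ, hμ, -⟩ := exists_catalan_rpow_measure hc
    exact ⟨μ, hμ⟩
  · obtain ⟨μ, hμ, -⟩ := exists_catalan_rpow_measure hc
    exact ⟨μ, hμ, fun ν hν => hdet hc hν hμ⟩
  · rintro rfl
    exact hdet hc hμ (by simpa using representsMoments_catalanMeasure)
  · obtain ⟨ν, hν, h⟩ := exists_catalan_rpow_measure hc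
    obtain rfl := hdet hc hμ hν
    obtain ⟨hint, hval⟩ := h s hs
    exact ⟨hint, hval, by rw [hval, gamma_duplication_catalan hs]⟩
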